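/- \textbf{Lemma 2 (Combinatorial CLT).} For each $n\ge 2$, on a probability space that may depend on $n$, let $\mathcal S\ge 1$ be an integer-valued random variable and let $s=1,\dots,\mathcal S$ denote strata of (random) sizes $n_s\ge 2$ with $\sum_{s=1}^{\mathcal S}n_s=n$. For each $s$ let $\{b_i^s\}_{i=1}^{n_s}$ and $\{c_i^s\}_{i=1}^{n_s}$ be real random variables (the joint distribution of $\mathcal S$, the $n_s$, the $b_i^s$ and the $c_i^s$ may vary with $n$). Suppose that (a) $\sum_{i=1}^{n_s}b_i^s=\sum_{i=1}^{n_s}c_i^s=0$ almost surely for every $s$; (b) $\sigma_n^2:=\sum_{s=1}^{\mathcal S}\frac{1}{n_s-1}\Big(\sum_{i=1}^{n_s}(b_i^s)^2\Big)\Big(\sum_{i=1}^{n_s}(c_i^s)^2\Big)\to\sigma^2$ in probability as $n\to\infty$, for a constant $\sigma^2>0$; (c) $\sum_{s=1}^{\mathcal S}n_s^{-1}\Big(\sum_{i=1}^{n_s}|b_i^s|^3\Big)\Big(\sum_{i=1}^{n_s}|c_i^s|^3\Big)\to 0$ in probability as $n\to\infty$; (d) $\sum_{s=1}^{\mathcal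 S}(n_s-1)^{-1}\Big(\sum_{i=1}^{n_s}(b_i^s)^4\Big)\Big(\sum_{i=1}^{n_s}(c_i^s)^4\Big)\to 0$ in probability as $n\to\infty$. Given these variables, let $\pi$ be uniformly distributed on the set $\mathbb S_n$ of stratified permutations, i.e. the permutations of the $n$ units $(s,i)$, $1\le s\le\mathcal S$, $1\le i\le n_s$, that map every stratum to itself; write $\pi(i)$ for the position within stratum $s$ of the image of $(s,i)$, and let $P^\pi$ denote probability with respect to $\pi$ only, all other variables being held fixed. Let $$T^\pi:=\frac{1}{\sigma_n}\sum_{s=1}^{\mathcal S}\sum_{i=1}^{n_s}b_i^s\,c_{\pi(i)}^s$$ (with $T^\pi:=0$ if $\sigma_n=0$, an event whose probability tends to $0$). Then, for every $t\in\mathbb R$, $P^\pi(T^\pi\le t)\to\Phi(t)$ in probability as $n\to\infty$, where $\Phi$ is the standard normal distribution function. -/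

import Mathlib

open MeasureTheory ProbabilityTheory Filter Topology

/-- Convergence in probability of `X n`, defined on the probability space `(Ω n, P n)`
(which may change with `n`), to the constant `a`. -/
def TendstoInProb {Ω : ℕ → Type*} [∀ n, MeasurableSpace (Ω n)] (P : ∀ n, Measure (Ω n))
    (X : ∀ n, Ω n → ℝ) (a : ℝ) : Prop :=
  ∀ ε : ℝ, 0 < ε → Tendsto (fun n => P n {ω | ε ≤ |X n ω - a|}) atTop (𝓝 0)

/-- The units of `S` strata of sizes `m 0, …, m (S - 1)`: the pair `⟨s, i⟩` is the
`i`-th unit of stratum `s` (both counted from `0`). -/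
abbrev StratUnit (S : ℕ) (m : ℕ → ℕ) : Type := Σ s : Fin S, Fin (m s)

/-- The stratified permutations: the permutations of all units that map
every stratum to itself. -/
def stratPerm (S : ℕ) (m : ℕ → ℕ) : Finset (Equiv.Perm (StratUnit S m)) :=
  Finset.univ.filter fun π => ∀ x, (π x).1 = x.1

theorem stratPerm_nonempty (S : ℕ) (m : ℕ → ℕ) : (stratPerm S m).Nonempty :=
  ⟨1, by simp [stratPerm]⟩

/-- The uniform distribution on the stratified permutations. -/
noncomputable def stratUniform (S : ℕ) (m : ℕ → ℕ) : PMF (Equiv.Perm (StratUnit S m)) :=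
  PMF.uniformOfFinset (stratPerm S m) (stratPerm_nonempty S m)

/-- `σ_n² = ∑ₛ (nₛ - 1)⁻¹ (∑ᵢ (bᵢˢ)²) (∑ᵢ (cᵢˢ)²)`. -/
noncomputable def stratVar (S : ℕ) (m : ℕ → ℕ) (b c : ℕ → ℕ → ℝ) : ℝ :=
  ∑ s ∈ Finset.range S, 1 / ((m s : ℝ) - 1) *
    (∑ i ∈ Finset.range (m s), b s i ^ 2) * (∑ i ∈ Finset.range (m s), c s i ^ 2)

/-- `∑ₛ nₛ⁻¹ (∑ᵢ |bᵢˢ|³) (∑ᵢ |cᵢˢ|³)`. -/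
noncomputable def stratThird (S : ℕ) (m : ℕ → ℕ) (b c : ℕ → ℕ → ℝ) : ℝ :=
  ∑ s ∈ Finset.range S, (m s : ℝ)⁻¹ *
    (∑ i ∈ Finset.range (m s), |b s i| ^ 3) * (∑ i ∈ Finset.range (m s), |c s i| ^ 3)

/-- `∑ₛ (nₛ - 1)⁻¹ (∑ᵢ (bᵢˢ)⁴) (∑ᵢ (cᵢˢ)⁴)`. -/
noncomputable def stratFourth (S : ℕ) (m : ℕ → ℕ) (b c : ℕ → ℕ → ℝ) : ℝ :=
  ∑ s ∈ Finset.range S, ((m s : ℝ) - 1)⁻¹ *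
    (∑ i ∈ Finset.range (m s), b s i ^ 4) * (∑ i ∈ Finset.range (m s), c s i ^ 4)

/-- `T^π = ∑ₛ ∑ᵢ bᵢˢ c_{π(i)}ˢ / σ_n`, for a permutation `π` of the units. -/
noncomputable def stratStat (S : ℕ) (m : ℕ → ℕ) (b c : ℕ → ℕ → ℝ)
    (π : Equiv.Perm (StratUnit S m)) : ℝ :=
  (∑ s : Fin S, ∑ i : Fin (m s), b s i * c s (π ⟨s, i⟩).2) / √(stratVar S m b c)

/-- `P^π(T^π ≤ t)`: the probability, for `π` uniform on the stratified permutations and with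
the strata and the scores held fixed, that `T^π ≤ t`. -/
noncomputable def stratProbLE (S : ℕ) (m : ℕ → ℕ) (b c : ℕ → ℕ → ℝ) (t : ℝ) : ℝ :=
  ((stratUniform S m).toOuterMeasure {π | stratStat S m b c π ≤ t}).toReal

/-!
The proof is Stein's method for characteristic functions, carried out for fixed scores.
Write `W = ∑ₛ ∑ᵢ bᵢˢ c_{π(i)}ˢ`, and let `d` denote minus the increment of `W` when `π` is composed
with the transposition of two positions of one stratum (`swapIncr`). Such a composition preserves
the uniform distribution and reverses the sign of `d`, and since the scores are centered, `d` sums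
to `2 nₛ Wₛ` over all pairs of positions of stratum `s`. This gives the exact identity
`stein_identity`, and a Taylor expansion of the exponential turns it into
`E[W exp(iuW)] ≈ iu E[V exp(iuW)]`, where `V` is a normalized sum of the squares `d²` (`steinVar`)
and the error is a multiple of the third moment term (`norm_expect_permSum_sub_steinVar_le`).

`V` concentrates around `σ²`. In each stratum it is half of `∑ᵢ (bᵢ c_{π(i)})²`, plus a constant,
plus `Wₛ² / nₛ` (`steinVar_eq`). The first term is again a linear permutation statistic, with
variance at most `∑ bᵢ⁴ ∑ cᵢ⁴ / (nₛ - 1)`; for the last one, `Wₛ² ≤ ∑ bᵢ² ∑ cᵢ²` reduces the fourth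
moment of `Wₛ` to the second (`expect_steinVar_sub_sq_le`). The strata being independent, the
variances add up, and the fourth moment term bounds `E (V - σ²)²`.

So the characteristic function `φ` of `W` satisfies `φ' = -σ² u φ` up to a small error
(`norm_expect_prodPermSum_sub_le`); an integrating factor bounds its distance to `exp(-σ² u² / 2)`
(`norm_prodPermCharFun_sub_le`). Lévy's continuity theorem then yields the `ε`-`δ` statement
`exists_delta_abs_stratProbLE_sub_lt` on deterministic scores, and the probability that random
scores violate its hypotheses tends to `0`.
-/

open scoped BigOperators

/-! ### Permutations of one stratum -/

section SinglePermutation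

variable {α : Type*}

/-- Minus the increment of `permSum x y` when the images of `i` and `j` are exchanged. -/
def swapIncr (x y : α → ℝ) (ρ : Equiv.Perm α) (i j : α) : ℝ :=
  (x i - x j) * (y (ρ i) - y (ρ j))

theorem swapIncr_mul_swap [DecidableEq α] (x y : α → ℝ) (ρ : Equiv.Perm α) (i j : α) :
    swapIncr x y (ρ * Equiv.swap i j) i j = -swapIncr x y ρ i j := by
  simp [swapIncr]; ring

variable [Fintype α]

/-- The linear permutation statistic `∑ᵢ xᵢ y_{ρ(i)}`. -/
def permSum (x y : α → ℝ) (ρ : Equiv.Perm α) : ℝ := ∑ i, x i * y (ρ i)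

/-- The conditional variance proxy of Stein's method: the mean square, suitably normalized, of the
increments of `permSum x y` over all pairs of positions. -/
noncomputable def steinVar (x y : α → ℝ) (ρ : Equiv.Perm α) : ℝ :=
  (4 * (Fintype.card α : ℝ))⁻¹ * ∑ i, ∑ j, swapIncr x y ρ i j ^ 2

theorem sum_swapIncr {x : α → ℝ} (y : α → ℝ) (hx : ∑ i, x i = 0) (ρ : Equiv.Perm α) :
    ∑ i, ∑ j, swapIncr x y ρ i j = 2 * Fintype.card α * permSum x y ρ := by
  have h : ∀ i j, swapIncr x y ρ i j =
      x i * y (ρ i) - x i * y (ρ j) - x j * y (ρ i) + x j * y (ρ j) := fun i j => by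
    unfold swapIncr; ring
  simp only [h, Finset.sum_add_distrib, Finset.sum_sub_distrib, ← Finset.mul_sum,
    ← Finset.sum_mul, hx, Finset.sum_const, Finset.card_univ, nsmul_eq_mul, permSum,
    mul_left_comm (x _) (Fintype.card α : ℝ)]
  ring

theorem steinVar_eq [Nonempty α] {x y : α → ℝ} (hx : ∑ i, x i = 0) (hy : ∑ i, y i = 0)
    (ρ : Equiv.Perm α) :
    steinVar x y ρ = permSum (fun i => x i ^ 2) (fun i => y i ^ 2) ρ / 2 +
      (∑ i, x i ^ 2) * (∑ i, y i ^ 2) / (2 * Fintype.card α) +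
      permSum x y ρ ^ 2 / Fintype.card α := by
  have hy' : ∑ i, y (ρ i) = 0 := by rw [Equiv.sum_comp ρ y, hy]
  have hy2 : ∑ i, y (ρ i) ^ 2 = ∑ i, y i ^ 2 := Equiv.sum_comp ρ (fun i => y i ^ 2)
  have h : ∀ i j, swapIncr x y ρ i j ^ 2 =
      x i ^ 2 * y (ρ i) ^ 2 + x i ^ 2 * y (ρ j) ^ 2 - 2 * (x i ^ 2 * y (ρ i)) * y (ρ j)
      + y (ρ i) ^ 2 * x j ^ 2 + x j ^ 2 * y (ρ j) ^ 2 - 2 * y (ρ i) * (x j ^ 2 * y (ρ j))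
      - 2 * (x i * y (ρ i) ^ 2) * x j - 2 * x i * (x j * y (ρ j) ^ 2)
      + 4 * (x i * y (ρ i)) * (x j * y (ρ j)) := fun i j => by
    unfold swapIncr; ring
  have hn : (Fintype.card α : ℝ) ≠ 0 := by simp
  have key : ∑ i, ∑ j, swapIncr x y ρ i j ^ 2 =
      2 * Fintype.card α * (∑ i, x i ^ 2 * y (ρ i) ^ 2) +
      2 * ((∑ i, x i ^ 2) * (∑ i, y i ^ 2)) + 4 * (∑ i, x i * y (ρ i)) ^ 2 := by
    simp only [h, Finset.sum_add_distrib, Finset.sum_sub_distrib, ← Finset.mul_sum,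
      ← Finset.sum_mul, hx, hy', hy2, Finset.sum_const, Finset.card_univ, nsmul_eq_mul,
      mul_left_comm (x _ ^ 2) (Fintype.card α : ℝ)]
    ring
  rw [steinVar, key, permSum, permSum]
  field_simp
  ring

theorem permSum_sq_le (x y : α → ℝ) (ρ : Equiv.Perm α) :
    permSum x y ρ ^ 2 ≤ (∑ i, x i ^ 2) * (∑ i, y i ^ 2) := by
  rw [← Equiv.sum_comp ρ (fun i => y i ^ 2)]
  exact Finset.sum_mul_sq_le_sq_mul_sq _ _ _

variable [DecidableEq α]

theorem permSum_mul_swap (x y : α → ℝ) (ρ : Equiv.Perm α) (i j : α) :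
    permSum x y (ρ * Equiv.swap i j) = permSum x y ρ - swapIncr x y ρ i j := by
  by_cases hij : i = j
  · subst hij; simp [swapIncr, ← Equiv.Perm.one_def]
  have hji : j ≠ i := Ne.symm hij
  have h : ∀ k, x k * y ((ρ * Equiv.swap i j) k) = x k * y (ρ k)
      + (if k = i then x i * (y (ρ j) - y (ρ i)) else 0)
      + (if k = j then x j * (y (ρ i) - y (ρ j)) else 0) := by
    intro k
    by_cases hi : k = i
    · subst hi; simp [hij]; ring
    by_cases hj : k = j
    · subst hj; simp [hji]; ring
    · simp [hi, hj, Equiv.swap_apply_of_ne_of_ne hi hj]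
  simp only [permSum, h, Finset.sum_add_distrib, Finset.sum_ite_eq', Finset.mem_univ, if_true,
    swapIncr]
  ring

/-- Stein's identity for the exchangeable pair obtained by composing with a transposition. It is
stated for a finite group `G` with a map `p` to the permutations of `α`, on which some
`φ g : G` acts as composition with `g`, so that it covers both `Equiv.Perm α` itself
and a product of permutation groups having it as a factor. -/
theorem stein_identity {G E : Type*} [Group G] [Fintype G] [AddCommGroup E] [Module ℝ E]
    [Nonempty α] (p : G → Equiv.Perm α) (φ : Equiv.Perm α → G) (h : ∀ π g, p (π * φ g) = p π * g)
    {x : α → ℝ} (y : α → ℝ) (hx : ∑ i, x i = 0) (F : G → E) :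
    ∑ π, permSum x y (p π) • F π = -(4 * (Fintype.card α : ℝ))⁻¹ •
      ∑ i, ∑ j, ∑ π, swapIncr x y (p π) i j • (F (π * φ (Equiv.swap i j)) - F π) := by
  -- the substitution `π ↦ π * φ (swap i j)` changes the sign of the increment
  have hs : ∀ i j, ∑ π, swapIncr x y (p π) i j • (F (π * φ (Equiv.swap i j)) - F π) =
      (-2 : ℝ) • ∑ π, swapIncr x y (p π) i j • F π := by
    intro i j
    have h1 := Equiv.sum_comp (Equiv.mulRight (φ (Equiv.swap i j)))
      (fun π => swapIncr x y (p π) i j • F π)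
    simp only [Equiv.coe_mulRight, h, swapIncr_mul_swap, neg_smul, Finset.sum_neg_distrib] at h1
    simp only [smul_sub, Finset.sum_sub_distrib, ← h1]
    rw [neg_eq_iff_eq_neg.1 h1]
    module
  have h2 : ∑ i, ∑ j, ∑ π, swapIncr x y (p π) i j • F π =
      (2 * (Fintype.card α : ℝ)) • ∑ π, permSum x y (p π) • F π := by
    rw [Finset.sum_congr rfl fun i _ => Finset.sum_comm, Finset.sum_comm, Finset.smul_sum]
    refine Finset.sum_congr rfl fun π _ => ?_
    simp only [← Finset.sum_smul, sum_swapIncr y hx, smul_smul]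
  have hn : (Fintype.card α : ℝ) ≠ 0 := by simp
  simp only [hs, ← Finset.smul_sum, h2, smul_smul]
  rw [show -(4 * (Fintype.card α : ℝ))⁻¹ * (-2 * (2 * Fintype.card α)) = 1 by field_simp; norm_num,
    one_smul]

open Finset in
/-- The image of a point under a uniform random permutation is uniform. -/
theorem expect_perm_apply (g : α → ℝ) (i : α) :
    𝔼 ρ : Equiv.Perm α, g (ρ i) = (∑ k, g k) / Fintype.card α := by
  have : Nonempty α := ⟨i⟩
  have h : ∀ j, 𝔼 ρ : Equiv.Perm α, g (ρ j) = 𝔼 ρ : Equiv.Perm α, g (ρ i) := fun j =>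
    Fintype.expect_equiv (Equiv.mulRight (Equiv.swap i j)) _ _ (by simp)
  have hn : (Fintype.card α : ℝ) ≠ 0 := by simp
  rw [eq_div_iff hn]
  calc (𝔼 ρ : Equiv.Perm α, g (ρ i)) * Fintype.card α
      = ∑ j, 𝔼 ρ : Equiv.Perm α, g (ρ j) := by simp [h, mul_comm]
    _ = 𝔼 ρ : Equiv.Perm α, ∑ j, g (ρ j) := (expect_sum_comm _ _ _).symm
    _ = ∑ k, g k := by simp [Equiv.sum_comp]

open Finset in
theorem expect_permSum [Nonempty α] (x y : α → ℝ) :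
    𝔼 ρ, permSum x y ρ = (∑ i, x i) * (∑ i, y i) / Fintype.card α := by
  simp only [permSum, expect_sum_comm, ← mul_expect, expect_perm_apply, ← Finset.sum_mul]
  ring

open Finset in
/-- Stein's identity for the test function `permSum x y` itself. -/
theorem expect_steinVar_eq [Nonempty α] {x : α → ℝ} (y : α → ℝ) (hx : ∑ i, x i = 0) :
    𝔼 ρ, steinVar x y ρ = 𝔼 ρ, permSum x y ρ ^ 2 := by
  have h := stein_identity (G := Equiv.Perm α) id id (fun _ _ => rfl) y hx (permSum x y)
  simp only [id, permSum_mul_swap, smul_eq_mul] at h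
  rw [Fintype.expect_eq_sum_div_card, Fintype.expect_eq_sum_div_card]
  congr 1
  simp only [pow_two, h, steinVar, ← Finset.mul_sum]
  rw [Finset.sum_comm (γ := Equiv.Perm α), Finset.sum_congr rfl fun i _ => Finset.sum_comm]
  simp only [sub_sub_cancel_left, mul_neg, Finset.sum_neg_distrib, neg_mul, neg_neg]

open Finset in
/-- The second moment of `permSum x y`: taking expectations in `steinVar_eq` gives a linear equation
for it, as `steinVar x y` has the same mean. -/
theorem expect_permSum_sq {x y : α → ℝ} (hn : 2 ≤ Fintype.card α) (hx : ∑ i, x i = 0)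
    (hy : ∑ i, y i = 0) :
    𝔼 ρ, permSum x y ρ ^ 2 = (∑ i, x i ^ 2) * (∑ i, y i ^ 2) / (Fintype.card α - 1) := by
  have : Nonempty α := Fintype.card_pos_iff.1 (by omega)
  have hn' : (2 : ℝ) ≤ Fintype.card α := by exact_mod_cast hn
  have h := expect_steinVar_eq y hx
  simp only [steinVar_eq hx hy, expect_add_distrib, ← expect_div, expect_permSum,
    Fintype.expect_const] at h
  have h1 : (Fintype.card α : ℝ) - 1 ≠ 0 := by linarith
  have h0 : (Fintype.card α : ℝ) ≠ 0 := by linarith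
  field_simp at h ⊢
  linarith

open Finset in
/-- The variance of `permSum x y`, for scores that need not be centered, is at most
what it would be if they were. -/
theorem expect_permSum_sub_sq_le (x y : α → ℝ) (hn : 2 ≤ Fintype.card α) :
    𝔼 ρ, (permSum x y ρ - (∑ i, x i) * (∑ i, y i) / Fintype.card α) ^ 2 ≤
      (∑ i, x i ^ 2) * (∑ i, y i ^ 2) / (Fintype.card α - 1) := by
  have hn' : (2 : ℝ) ≤ Fintype.card α := by exact_mod_cast hn
  have h0 : (Fintype.card α : ℝ) ≠ 0 := by linarith
  have hc : ∀ z : α → ℝ, ∑ i, (z i - (∑ i, z i) / Fintype.card α) = 0 := fun z => by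
    simp only [Finset.sum_sub_distrib, Finset.sum_const, Finset.card_univ, nsmul_eq_mul]
    field_simp; ring
  have hc2 : ∀ z : α → ℝ, ∑ i, (z i - (∑ i, z i) / Fintype.card α) ^ 2 ≤ ∑ i, z i ^ 2 := by
    intro z
    have : ∑ i, (z i - (∑ i, z i) / Fintype.card α) ^ 2 =
        ∑ i, z i ^ 2 - (∑ i, z i) ^ 2 / Fintype.card α := by
      simp only [sub_sq, Finset.sum_sub_distrib, Finset.sum_add_distrib, Finset.sum_const,
        Finset.card_univ, nsmul_eq_mul, ← Finset.sum_mul, ← Finset.mul_sum]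
      field_simp; ring
    rw [this]
    have : 0 ≤ (∑ i, z i) ^ 2 / Fintype.card α := by positivity
    linarith
  have h := expect_permSum_sq hn (hc x) (hc y)
  have he : ∀ ρ, permSum x y ρ - (∑ i, x i) * (∑ i, y i) / Fintype.card α =
      permSum (fun i => x i - (∑ i, x i) / Fintype.card α)
        (fun i => y i - (∑ i, y i) / Fintype.card α) ρ := by
    intro ρ
    have := Equiv.sum_comp ρ y
    simp only [permSum, sub_mul, mul_sub, Finset.sum_sub_distrib, ← Finset.mul_sum,
      ← Finset.sum_mul, this, Finset.sum_const, Finset.card_univ, nsmul_eq_mul]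
    field_simp; ring
  simp only [he, h]
  have : (0 : ℝ) ≤ Fintype.card α - 1 := by linarith
  exact div_le_div_of_nonneg_right (mul_le_mul (hc2 x) (hc2 y)
    (Finset.sum_nonneg fun _ _ => sq_nonneg _) (Finset.sum_nonneg fun _ _ => sq_nonneg _)) this

open Finset in
/-- The variance proxy concentrates around its mean when the fourth moments are small. -/
theorem expect_steinVar_sub_sq_le {x y : α → ℝ} (hn : 2 ≤ Fintype.card α) (hx : ∑ i, x i = 0)
    (hy : ∑ i, y i = 0) :
    𝔼 ρ, (steinVar x y ρ - (∑ i, x i ^ 2) * (∑ i, y i ^ 2) / (Fintype.card α - 1)) ^ 2 ≤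
      5 / 2 * ((∑ i, x i ^ 4) * (∑ i, y i ^ 4) / (Fintype.card α - 1)) := by
  have : Nonempty α := Fintype.card_pos_iff.1 (by omega)
  have hn' : (2 : ℝ) ≤ Fintype.card α := by exact_mod_cast hn
  set n : ℝ := (Fintype.card α : ℝ)
  set B := ∑ i, x i ^ 2
  set C := ∑ i, y i ^ 2
  have hB0 : 0 ≤ B := Finset.sum_nonneg fun _ _ => by positivity
  have hC0 : 0 ≤ C := Finset.sum_nonneg fun _ _ => by positivity
  set B4 := ∑ i, x i ^ 4
  set C4 := ∑ i, y i ^ 4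
  have hB40 : 0 ≤ B4 := Finset.sum_nonneg fun _ _ => by positivity
  have hB : B ^ 2 ≤ n * B4 := by
    have := sq_sum_le_card_mul_sum_sq (s := Finset.univ) (f := fun i => x i ^ 2)
    simpa only [← pow_mul, Finset.card_univ] using this
  have hC : C ^ 2 ≤ n * C4 := by
    have := sq_sum_le_card_mul_sum_sq (s := Finset.univ) (f := fun i => y i ^ 2)
    simpa only [← pow_mul, Finset.card_univ] using this
  have hn1 : 0 < n - 1 := by linarith
  have hn0 : 0 < n := by linarith
  have hQ := expect_permSum_sub_sq_le (fun i => x i ^ 2) (fun i => y i ^ 2) hn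
  simp only [← pow_mul] at hQ
  norm_num only at hQ
  change 𝔼 ρ, (permSum (fun i => x i ^ 2) (fun i => y i ^ 2) ρ - B * C / n) ^ 2 ≤
    B4 * C4 / (n - 1) at hQ
  have hW := expect_permSum_sq hn hx hy
  change 𝔼 ρ, permSum x y ρ ^ 2 = B * C / (n - 1) at hW
  have hpt : ∀ ρ, (steinVar x y ρ - B * C / (n - 1)) ^ 2 ≤
      1 / 2 * (permSum (fun i => x i ^ 2) (fun i => y i ^ 2) ρ - B * C / n) ^ 2 +
      2 / n ^ 2 * (B * C * permSum x y ρ ^ 2 - 2 * (B * C / (n - 1)) * permSum x y ρ ^ 2 +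
        (B * C / (n - 1)) ^ 2) := by
    intro ρ
    have hle := permSum_sq_le x y ρ
    rw [steinVar_eq hx hy]
    change (permSum (fun i => x i ^ 2) (fun i => y i ^ 2) ρ / 2 + B * C / (2 * n) +
      permSum x y ρ ^ 2 / n - B * C / (n - 1)) ^ 2 ≤ _
    have hsplit : permSum (fun i => x i ^ 2) (fun i => y i ^ 2) ρ / 2 + B * C / (2 * n) +
        permSum x y ρ ^ 2 / n - B * C / (n - 1) =
        1 / 2 * (permSum (fun i => x i ^ 2) (fun i => y i ^ 2) ρ - B * C / n) +
        1 / n * (permSum x y ρ ^ 2 - B * C / (n - 1)) := by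
      field_simp; ring
    rw [hsplit]
    -- by Cauchy–Schwarz, a bound on the fourth power that is linear in the square
    have hW4 : (permSum x y ρ ^ 2) ^ 2 ≤ B * C * permSum x y ρ ^ 2 := by
      rw [pow_two (permSum x y ρ ^ 2)]
      exact mul_le_mul_of_nonneg_right hle (sq_nonneg _)
    have hab : ∀ a b : ℝ, (a + b) ^ 2 ≤ 2 * a ^ 2 + 2 * b ^ 2 := fun a b => by
      nlinarith [sq_nonneg (a - b)]
    refine (hab _ _).trans (add_le_add (le_of_eq (by ring)) ?_)
    calc 2 * (1 / n * (permSum x y ρ ^ 2 - B * C / (n - 1))) ^ 2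
        = 2 / n ^ 2 * ((permSum x y ρ ^ 2) ^ 2 - 2 * (B * C / (n - 1)) * permSum x y ρ ^ 2 +
        (B * C / (n - 1)) ^ 2) := by ring
      _ ≤ _ := by gcongr
  refine (expect_le_expect fun ρ _ => hpt ρ).trans ?_
  simp only [expect_add_distrib, expect_sub_distrib, ← mul_expect, hW, Fintype.expect_const]
  have hfin : 2 / n ^ 2 * (B * C * (B * C / (n - 1)) - 2 * (B * C / (n - 1)) * (B * C / (n - 1)) +
      (B * C / (n - 1)) ^ 2) ≤ 2 * (B4 * C4 / (n - 1)) := by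
    calc _ = 2 / n ^ 2 * (B ^ 2 * C ^ 2 / (n - 1) - (B * C / (n - 1)) ^ 2) := by ring
      _ ≤ 2 / n ^ 2 * (B ^ 2 * C ^ 2 / (n - 1)) := by
        gcongr; linarith [sq_nonneg (B * C / (n - 1))]
      _ ≤ 2 / n ^ 2 * ((n * B4) * (n * C4) / (n - 1)) := by gcongr
      _ = _ := by field_simp
  linarith

theorem abs_sub_pow_three_le (a b : ℝ) : |a - b| ^ 3 ≤ 4 * (|a| ^ 3 + |b| ^ 3) := by
  have h : |a - b| ≤ |a| + |b| := abs_sub a b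
  calc |a - b| ^ 3 ≤ (|a| + |b|) ^ 3 := by gcongr
    _ ≤ 4 * (|a| ^ 3 + |b| ^ 3) := by
      nlinarith [mul_nonneg (add_nonneg (abs_nonneg a) (abs_nonneg b)) (sq_nonneg (|a| - |b|))]

open Finset in
theorem sum_expect_abs_swapIncr_pow_three_le [Nonempty α] (x y : α → ℝ) :
    ∑ i, ∑ j, 𝔼 ρ, |swapIncr x y ρ i j| ^ 3 ≤ 64 * ((∑ i, |x i| ^ 3) * (∑ i, |y i| ^ 3)) := by
  have hn : (Fintype.card α : ℝ) ≠ 0 := by simp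
  have h1 : ∀ i j, 𝔼 ρ, |swapIncr x y ρ i j| ^ 3 ≤
      4 * (|x i| ^ 3 + |x j| ^ 3) * (8 * (∑ k, |y k| ^ 3) / Fintype.card α) := by
    intro i j
    have h2 : 𝔼 ρ : Equiv.Perm α, |y (ρ i) - y (ρ j)| ^ 3 ≤
        8 * (∑ k, |y k| ^ 3) / Fintype.card α := by
      refine (expect_le_expect fun ρ _ => abs_sub_pow_three_le _ _).trans (le_of_eq ?_)
      rw [← mul_expect, expect_add_distrib, expect_perm_apply (fun k => |y k| ^ 3),
        expect_perm_apply (fun k => |y k| ^ 3)]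
      ring
    simp only [swapIncr, abs_mul, mul_pow, ← mul_expect]
    exact mul_le_mul (abs_sub_pow_three_le _ _) h2 (expect_nonneg fun _ _ => by positivity)
      (by positivity)
  refine (Finset.sum_le_sum fun i _ => Finset.sum_le_sum fun j _ => h1 i j).trans (le_of_eq ?_)
  simp only [← Finset.sum_mul, ← Finset.mul_sum, Finset.sum_add_distrib, Finset.sum_const,
    Finset.card_univ, nsmul_eq_mul]
  field_simp
  ring

end SinglePermutation

/-! ### Independent permutations of several strata -/

section ProductOfPermutations

open Finset Complex

variable {ι : Type*} [Fintype ι] [DecidableEq ι] {α : ι → Type*} [∀ s, Fintype (α s)]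
  [∀ s, DecidableEq (α s)]

/-- A coordinate of a uniform element of a product of permutation groups is uniform. -/
theorem expect_pi_perm_apply (s : ι) (X : Equiv.Perm (α s) → ℝ) :
    𝔼 π : ∀ s, Equiv.Perm (α s), X (π s) = 𝔼 ρ, X ρ := by
  have h : ∀ ρ : Equiv.Perm (α s), 𝔼 π : ∀ s, Equiv.Perm (α s), X (π s * ρ) =
      𝔼 π : ∀ s, Equiv.Perm (α s), X (π s) := fun ρ =>
    Fintype.expect_equiv (Equiv.mulRight (Pi.mulSingle s ρ)) _ _ (by simp)
  have h2 : ∀ σ : Equiv.Perm (α s), 𝔼 ρ, X (σ * ρ) = 𝔼 ρ, X ρ := fun σ =>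
    Fintype.expect_equiv (Equiv.mulLeft σ) _ _ (by simp)
  rw [← Fintype.expect_const (ι := Equiv.Perm (α s)) (𝔼 π : ∀ s, Equiv.Perm (α s), X (π s)),
    ← Fintype.expect_const (ι := ∀ s, Equiv.Perm (α s)) (𝔼 ρ, X ρ)]
  rw [← expect_congr rfl fun ρ _ => h ρ, expect_comm]
  exact expect_congr rfl fun π _ => h2 (π s)

/-- Centered functions of different coordinates are uncorrelated. -/
theorem expect_pi_perm_mul_eq_zero {s t : ι} (hst : s ≠ t) {X : Equiv.Perm (α s) → ℝ}
    (hX : 𝔼 ρ, X ρ = 0) (Y : Equiv.Perm (α t) → ℝ) :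
    𝔼 π : ∀ s, Equiv.Perm (α s), X (π s) * Y (π t) = 0 := by
  have h : ∀ ρ : Equiv.Perm (α s), 𝔼 π : ∀ s, Equiv.Perm (α s), X (π s * ρ) * Y (π t) =
      𝔼 π : ∀ s, Equiv.Perm (α s), X (π s) * Y (π t) := fun ρ =>
    Fintype.expect_equiv (Equiv.mulRight (Pi.mulSingle s ρ)) _ _ (by simp [hst.symm])
  have h2 : ∀ σ : Equiv.Perm (α s), 𝔼 ρ, X (σ * ρ) = 0 := fun σ => by
    rw [← hX]
    exact Fintype.expect_equiv (Equiv.mulLeft σ) _ _ (by simp)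
  rw [← Fintype.expect_const (ι := Equiv.Perm (α s))
    (𝔼 π : ∀ s, Equiv.Perm (α s), X (π s) * Y (π t)), ← expect_congr rfl fun ρ _ => h ρ, expect_comm]
  exact expect_eq_zero fun π _ => by rw [← expect_mul, h2, zero_mul]

/-- The variance of a sum of centered functions of the coordinates. -/
theorem expect_sq_sum_pi_perm {X : ∀ s, Equiv.Perm (α s) → ℝ} (hX : ∀ s, 𝔼 ρ, X s ρ = 0) :
    𝔼 π : ∀ s, Equiv.Perm (α s), (∑ s, X s (π s)) ^ 2 = ∑ s, 𝔼 ρ, X s ρ ^ 2 := by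
  simp only [pow_two, sum_mul_sum, expect_sum_comm]
  refine sum_congr rfl fun s _ => ?_
  rw [sum_eq_single s (fun t _ hts => expect_pi_perm_mul_eq_zero hts.symm (hX s) (X t)) (by simp)]
  exact expect_pi_perm_apply s fun ρ => X s ρ * X s ρ

/-- `∑ₛ ∑ᵢ xᵢˢ y_{π(i)}ˢ`, for a family `π` of permutations of the strata. -/
def prodPermSum (x y : ∀ s, α s → ℝ) (π : ∀ s, Equiv.Perm (α s)) : ℝ :=
  ∑ s, permSum (x s) (y s) (π s)

/-- The characteristic function of `prodPermSum x y` under the uniform distribution. -/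
noncomputable def prodPermCharFun (x y : ∀ s, α s → ℝ) (u : ℝ) : ℂ :=
  𝔼 π, exp ((u * prodPermSum x y π : ℝ) * I)

theorem norm_exp_mul_I_sub_one_sub_le (r : ℝ) : ‖exp (r * I) - 1 - r * I‖ ≤ 3 * r ^ 2 := by
  have hr : ‖(r : ℂ) * I‖ = |r| := by simp
  rcases le_total |r| 1 with h | h
  · have := norm_exp_sub_one_sub_id_le (x := r * I) (by rwa [hr])
    rw [hr, sq_abs] at this
    linarith [sq_nonneg r]
  · calc ‖exp (r * I) - 1 - r * I‖ ≤ ‖exp (r * I)‖ + ‖(1 : ℂ)‖ + ‖(r : ℂ) * I‖ :=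
        (norm_sub_le _ _).trans (add_le_add_left (norm_sub_le _ _) _)
      _ = 2 + |r| := by rw [norm_exp_ofReal_mul_I, hr, norm_one]; ring
      _ ≤ 3 * r ^ 2 := by rw [← sq_abs r]; nlinarith

theorem expect_abs_le_sqrt {β : Type*} [Fintype β] [Nonempty β] {f : β → ℝ} {C : ℝ}
    (h : 𝔼 b, f b ^ 2 ≤ C) : 𝔼 b, |f b| ≤ √C := by
  refine Real.le_sqrt_of_sq_le (le_trans ?_ h)
  simpa using expect_mul_sq_le_sq_mul_sq univ (fun b => |f b|) fun _ => (1 : ℝ)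

/-- The contribution of one stratum to Stein's equation, tested against the exponentials. -/
theorem norm_expect_permSum_sub_steinVar_le (x y : ∀ s, α s → ℝ) (s : ι) [Nonempty (α s)]
    (hx : ∑ i, x s i = 0) (u : ℝ) :
    ‖𝔼 π : ∀ s, Equiv.Perm (α s), ((permSum (x s) (y s) (π s) : ℂ) -
        u * I * steinVar (x s) (y s) (π s)) * exp ((u * prodPermSum x y π : ℝ) * I)‖ ≤
      48 * u ^ 2 *
        ((Fintype.card (α s) : ℝ)⁻¹ * (∑ i, |x s i| ^ 3) * (∑ i, |y s i| ^ 3)) := by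
  set n : ℝ := (Fintype.card (α s) : ℝ) with hndef
  have hn : 0 < n := by simp [hndef, Fintype.card_pos]
  set F : (∀ s, Equiv.Perm (α s)) → ℂ := fun π => exp ((u * prodPermSum x y π : ℝ) * I) with hF
  have hF1 : ∀ π, ‖F π‖ = 1 := fun π => norm_exp_ofReal_mul_I _
  -- the effect of a transposition within stratum `s` on the exponential
  have hswap : ∀ π i j, F (π * Pi.mulSingle s (Equiv.swap i j)) =
      F π * exp ((-(u * swapIncr (x s) (y s) (π s) i j) : ℝ) * I) := by
    intro π i j
    have : prodPermSum x y (π * Pi.mulSingle s (Equiv.swap i j)) =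
        prodPermSum x y π - swapIncr (x s) (y s) (π s) i j := by
      rw [prodPermSum, prodPermSum, ← sum_erase_add _ _ (mem_univ s),
        ← sum_erase_add (a := s) univ _ (mem_univ s), Pi.mul_apply, Pi.mulSingle_eq_same,
        permSum_mul_swap, add_sub_assoc]
      congr 1
      exact sum_congr rfl fun t ht => by
        rw [Pi.mul_apply, Pi.mulSingle_eq_of_ne (ne_of_mem_erase ht), mul_one]
    simp only [hF, this, ← Complex.exp_add]
    congr 1
    push_cast
    ring
  have hst := stein_identity (G := ∀ s, Equiv.Perm (α s)) (fun π => π s)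
    (fun g => Pi.mulSingle (M := fun s => Equiv.Perm (α s)) s g)
    (fun π g => by simp) (y s) hx F
  have hsum : ∑ π, ((permSum (x s) (y s) (π s) : ℂ) - u * I * steinVar (x s) (y s) (π s)) * F π =
      -(4 * n : ℂ)⁻¹ * ∑ i, ∑ j, ∑ π, swapIncr (x s) (y s) (π s) i j *
        (F π * (exp ((-(u * swapIncr (x s) (y s) (π s) i j) : ℝ) * I) - 1
          - (-(u * swapIncr (x s) (y s) (π s) i j) : ℝ) * I)) := by
    simp only [hswap, real_smul, ← hndef] at hst
    have hV : ∑ π, (u * I * steinVar (x s) (y s) (π s)) * F π = (4 * n : ℂ)⁻¹ *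
        ∑ i, ∑ j, ∑ π, swapIncr (x s) (y s) (π s) i j *
          (F π * (u * swapIncr (x s) (y s) (π s) i j * I)) := by
      rw [Finset.sum_congr rfl fun i _ => Finset.sum_comm, Finset.sum_comm, mul_sum]
      refine sum_congr rfl fun π _ => ?_
      simp only [steinVar, ← hndef]
      push_cast
      simp only [mul_sum, sum_mul]
      exact sum_congr rfl fun i _ => sum_congr rfl fun j _ => by ring
    simp only [sub_mul _ _ (F _), sum_sub_distrib, hst, hV]
    push_cast
    rw [neg_mul, neg_mul, ← neg_add', ← mul_add]
    simp only [← sum_add_distrib]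
    congr 2
    exact sum_congr rfl fun i _ => sum_congr rfl fun j _ => sum_congr rfl fun π _ => by ring
  have hbd : ‖∑ i, ∑ j, ∑ π, swapIncr (x s) (y s) (π s) i j *
        (F π * (exp ((-(u * swapIncr (x s) (y s) (π s) i j) : ℝ) * I) - 1
          - (-(u * swapIncr (x s) (y s) (π s) i j) : ℝ) * I))‖ ≤
      ∑ i, ∑ j, ∑ π : ∀ s, Equiv.Perm (α s), 3 * u ^ 2 * |swapIncr (x s) (y s) (π s) i j| ^ 3 := by
    refine norm_sum_le_of_le _ fun i _ => norm_sum_le_of_le _ fun j _ =>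
      norm_sum_le_of_le _ fun π _ => ?_
    rw [norm_mul, norm_mul, hF1, one_mul, norm_real, Real.norm_eq_abs]
    refine (mul_le_mul_of_nonneg_left (norm_exp_mul_I_sub_one_sub_le _) (abs_nonneg _)).trans
      (le_of_eq ?_)
    rw [neg_sq, mul_pow, ← sq_abs (swapIncr (x s) (y s) (π s) i j)]
    ring
  set N : ℝ := (Fintype.card (∀ s, Equiv.Perm (α s)) : ℝ) with hN
  have hN0 : 0 < N := Nat.cast_pos.2 Fintype.card_pos
  have hthird := sum_expect_abs_swapIncr_pow_three_le (x s) (y s)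
  have hmean : ∑ i, ∑ j, ∑ π : ∀ s, Equiv.Perm (α s),
      3 * u ^ 2 * |swapIncr (x s) (y s) (π s) i j| ^ 3 =
      3 * u ^ 2 * N * ∑ i, ∑ j, 𝔼 ρ, |swapIncr (x s) (y s) ρ i j| ^ 3 := by
    have : ∀ i j, ∑ π : ∀ s, Equiv.Perm (α s), |swapIncr (x s) (y s) (π s) i j| ^ 3 =
        N * 𝔼 ρ, |swapIncr (x s) (y s) ρ i j| ^ 3 := fun i j => by
      rw [← expect_pi_perm_apply s fun ρ => |swapIncr (x s) (y s) ρ i j| ^ 3,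
        Fintype.card_mul_expect]
    simp only [← mul_sum, this, mul_assoc]
  rw [Fintype.expect_eq_sum_div_card, hsum, norm_div, norm_mul, Complex.norm_natCast, ← hN,
    div_le_iff₀ hN0, norm_neg, norm_inv, norm_mul, norm_real, Real.norm_of_nonneg hn.le,
    show ‖(4 : ℂ)‖ = 4 by simp]
  calc (4 * n)⁻¹ * _ ≤ (4 * n)⁻¹ * (3 * u ^ 2 * N *
        (64 * ((∑ i, |x s i| ^ 3) * (∑ i, |y s i| ^ 3)))) := by
        refine mul_le_mul_of_nonneg_left (hbd.trans ?_) (by positivity)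
        rw [hmean]
        exact mul_le_mul_of_nonneg_left hthird (by positivity)
    _ = _ := by field_simp; ring

/-- The variance `∑ₛ (nₛ - 1)⁻¹ (∑ᵢ (xᵢˢ)²) (∑ᵢ (yᵢˢ)²)`. -/
noncomputable def prodVar (x y : ∀ s, α s → ℝ) : ℝ :=
  ∑ s, (∑ i, x s i ^ 2) * (∑ i, y s i ^ 2) / (Fintype.card (α s) - 1)

/-- The third moment term `∑ₛ nₛ⁻¹ (∑ᵢ |xᵢˢ|³) (∑ᵢ |yᵢˢ|³)`. -/
noncomputable def prodThird (x y : ∀ s, α s → ℝ) : ℝ :=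
  ∑ s, (Fintype.card (α s) : ℝ)⁻¹ * (∑ i, |x s i| ^ 3) * (∑ i, |y s i| ^ 3)

/-- The fourth moment term `∑ₛ (nₛ - 1)⁻¹ (∑ᵢ (xᵢˢ)⁴) (∑ᵢ (yᵢˢ)⁴)`. -/
noncomputable def prodFourth (x y : ∀ s, α s → ℝ) : ℝ :=
  ∑ s, (∑ i, x s i ^ 4) * (∑ i, y s i ^ 4) / (Fintype.card (α s) - 1)

variable {x y : ∀ s, α s → ℝ}

omit [∀ s, DecidableEq (α s)] [DecidableEq ι] in
theorem prodThird_nonneg : 0 ≤ prodThird x y :=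
  sum_nonneg fun _ _ => by positivity

theorem expect_abs_steinVar_sub_le (hn : ∀ s, 2 ≤ Fintype.card (α s))
    (hx : ∀ s, ∑ i, x s i = 0) (hy : ∀ s, ∑ i, y s i = 0) :
    𝔼 π : ∀ s, Equiv.Perm (α s), |∑ s, steinVar (x s) (y s) (π s) - prodVar x y| ≤
      √(5 / 2 * prodFourth x y) := by
  refine expect_abs_le_sqrt ?_
  simp only [prodVar, ← sum_sub_distrib]
  have h0 : ∀ s, 𝔼 ρ, (steinVar (x s) (y s) ρ -
      (∑ i, x s i ^ 2) * (∑ i, y s i ^ 2) / (Fintype.card (α s) - 1)) = 0 := fun s => by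
    have : Nonempty (α s) := Fintype.card_pos_iff.1 (by linarith [hn s])
    rw [expect_sub_distrib, Fintype.expect_const, expect_steinVar_eq _ (hx s),
      expect_permSum_sq (hn s) (hx s) (hy s), sub_self]
  rw [expect_sq_sum_pi_perm (X := fun s ρ => steinVar (x s) (y s) ρ -
      (∑ i, x s i ^ 2) * (∑ i, y s i ^ 2) / (Fintype.card (α s) - 1)) h0, prodFourth, mul_sum]
  exact sum_le_sum fun s _ => expect_steinVar_sub_sq_le (hn s) (hx s) (hy s)

/-- The characteristic function satisfies the differential equation `φ' = -σ² u φ` of the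
Gaussian one up to a small error. -/
theorem norm_expect_prodPermSum_sub_le (hn : ∀ s, 2 ≤ Fintype.card (α s))
    (hx : ∀ s, ∑ i, x s i = 0) (hy : ∀ s, ∑ i, y s i = 0) (u : ℝ) :
    ‖(𝔼 π, (prodPermSum x y π : ℂ) * exp ((u * prodPermSum x y π : ℝ) * I)) -
        u * I * prodVar x y * prodPermCharFun x y u‖ ≤
      48 * u ^ 2 * prodThird x y + |u| * √(5 / 2 * prodFourth x y) := by
  have hne : ∀ s, Nonempty (α s) := fun s => Fintype.card_pos_iff.1 (by linarith [hn s])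
  have hsplit : (𝔼 π, (prodPermSum x y π : ℂ) * exp ((u * prodPermSum x y π : ℝ) * I)) -
      u * I * prodVar x y * prodPermCharFun x y u =
      ∑ s, (𝔼 π : ∀ s, Equiv.Perm (α s), ((permSum (x s) (y s) (π s) : ℂ) -
        u * I * steinVar (x s) (y s) (π s)) * exp ((u * prodPermSum x y π : ℝ) * I)) +
      𝔼 π : ∀ s, Equiv.Perm (α s), u * I * (∑ s, steinVar (x s) (y s) (π s) - prodVar x y : ℝ) *
        exp ((u * prodPermSum x y π : ℝ) * I) := by
    rw [prodPermCharFun, mul_expect, ← expect_sub_distrib, ← expect_sum_comm, ← expect_add_distrib]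
    refine expect_congr rfl fun π _ => ?_
    rw [← sum_mul, sum_sub_distrib, ← mul_sum]
    simp only [prodPermSum]
    push_cast
    ring
  rw [hsplit]
  refine (norm_add_le _ _).trans (add_le_add ?_ ?_)
  · rw [prodThird, mul_sum]
    exact norm_sum_le_of_le _ fun s _ => norm_expect_permSum_sub_steinVar_le x y s (hx s) u
  · refine (RCLike.norm_expect_le (K := ℂ)).trans ?_
    simp only [norm_mul, norm_exp_ofReal_mul_I, norm_real, norm_I, mul_one, Real.norm_eq_abs,
      ← mul_expect]
    exact mul_le_mul_of_nonneg_left (expect_abs_steinVar_sub_le hn hx hy) (abs_nonneg _)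

theorem prodPermCharFun_zero :
    prodPermCharFun x y 0 = 1 := by
  simp [prodPermCharFun]

theorem hasDerivAt_prodPermCharFun (u : ℝ) :
    HasDerivAt (prodPermCharFun x y)
      (I * 𝔼 π, (prodPermSum x y π : ℂ) * exp ((u * prodPermSum x y π : ℝ) * I)) u := by
  have h : ∀ w : ℝ, HasDerivAt (fun u : ℝ => exp ((u * w : ℝ) * I))
      (I * (w * exp ((u * w : ℝ) * I))) u := by
    intro w
    have h1 : HasDerivAt (fun u : ℝ => ((u * w : ℝ) : ℂ) * I) (w * I) u := by
      have := (((hasDerivAt_id u).mul_const w).ofReal_comp).mul_const I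
      simpa using this
    convert h1.cexp using 1
    ring
  simp only [Fintype.expect_eq_sum_div_card, mul_div_assoc', mul_sum]
  have := (HasDerivAt.fun_sum (u := univ) fun π _ => h (prodPermSum x y π)).div_const
    (Fintype.card (∀ s, Equiv.Perm (α s)) : ℂ)
  unfold prodPermCharFun
  simpa only [Fintype.expect_eq_sum_div_card] using this

/-- Quantitative central limit theorem for the characteristic function. -/
theorem norm_prodPermCharFun_sub_le (hn : ∀ s, 2 ≤ Fintype.card (α s))
    (hx : ∀ s, ∑ i, x s i = 0) (hy : ∀ s, ∑ i, y s i = 0) (u : ℝ) :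
    ‖prodPermCharFun x y u - Real.exp (-(prodVar x y * u ^ 2 / 2))‖ ≤
      |u| * (48 * u ^ 2 * prodThird x y + |u| * √(5 / 2 * prodFourth x y)) := by
  set v := prodVar x y with hv
  have hv0 : 0 ≤ v := by
    refine sum_nonneg fun s _ => div_nonneg (mul_nonneg (sum_nonneg fun _ _ => sq_nonneg _)
      (sum_nonneg fun _ _ => sq_nonneg _)) ?_
    have : (2 : ℝ) ≤ Fintype.card (α s) := by exact_mod_cast hn s
    linarith
  -- the integrating factor, normalized to be at most `1` between `0` and `u`
  set g : ℝ → ℂ := fun r => (Real.exp (v * r ^ 2 / 2 - v * u ^ 2 / 2) : ℝ) * prodPermCharFun x y r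
  set M := 48 * u ^ 2 * prodThird x y + |u| * √(5 / 2 * prodFourth x y)
  have hderiv : ∀ r, HasDerivAt g ((Real.exp (v * r ^ 2 / 2 - v * u ^ 2 / 2) : ℝ) *
      (I * ((𝔼 π, (prodPermSum x y π : ℂ) * exp ((r * prodPermSum x y π : ℝ) * I)) -
        r * I * v * prodPermCharFun x y r))) r := by
    intro r
    have h1 : HasDerivAt (fun r => Real.exp (v * r ^ 2 / 2 - v * u ^ 2 / 2))
        (Real.exp (v * r ^ 2 / 2 - v * u ^ 2 / 2) * (v * r)) r := by
      have : HasDerivAt (fun r : ℝ => v * r ^ 2 / 2 - v * u ^ 2 / 2) (v * r) r := by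
        refine ((((hasDerivAt_pow 2 r).const_mul v).div_const 2).sub_const
          (v * u ^ 2 / 2)).congr_deriv ?_
        norm_num
        ring
      exact this.exp
    refine (h1.ofReal_comp.mul (hasDerivAt_prodPermCharFun (x := x) (y := y) r)).congr_deriv ?_
    push_cast
    linear_combination (Complex.exp (v * r ^ 2 / 2 - v * u ^ 2 / 2) * r * v *
      prodPermCharFun x y r) * I_sq
  have hbound : ∀ r ∈ Set.uIcc 0 u, ‖(Real.exp (v * r ^ 2 / 2 - v * u ^ 2 / 2) : ℝ) *
      (I * ((𝔼 π, (prodPermSum x y π : ℂ) * exp ((r * prodPermSum x y π : ℝ) * I)) -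
        r * I * v * prodPermCharFun x y r))‖ ≤ M := by
    intro r hr
    have hru : |r| ≤ |u| := by
      have := Set.abs_sub_left_of_mem_uIcc hr
      simpa using this
    have hsq : r ^ 2 ≤ u ^ 2 := sq_le_sq.2 hru
    have hexp : Real.exp (v * r ^ 2 / 2 - v * u ^ 2 / 2) ≤ 1 := by
      rw [Real.exp_le_one_iff]
      nlinarith
    rw [norm_mul, norm_mul, norm_I, one_mul, norm_real, Real.norm_of_nonneg (Real.exp_nonneg _)]
    refine (mul_le_of_le_one_left (norm_nonneg _) hexp).trans
      ((norm_expect_prodPermSum_sub_le hn hx hy r).trans ?_)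
    have := prodThird_nonneg (x := x) (y := y)
    change _ ≤ 48 * u ^ 2 * prodThird x y + |u| * √(5 / 2 * prodFourth x y)
    gcongr
  have := (convex_uIcc 0 u).norm_image_sub_le_of_norm_hasDerivWithin_le
    (fun r _ => (hderiv r).hasDerivWithinAt) hbound Set.left_mem_uIcc Set.right_mem_uIcc
  simp only [g, prodPermCharFun_zero, sub_self, Real.exp_zero] at this
  simp only [ne_eq, OfNat.ofNat_ne_zero, not_false_eq_true, zero_pow, mul_zero, zero_div, zero_sub,
    ofReal_one, one_mul, mul_one, sub_zero, Real.norm_eq_abs] at this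
  rwa [mul_comm M] at this

end ProductOfPermutations

/-! ### Laws of functions on a finite uniform space -/

section UniformLaw

variable {β : Type*} [Fintype β] [Nonempty β]

/-- The law of `f` under the uniform distribution on `β`. -/
noncomputable def uniformLaw (f : β → ℝ) : Measure ℝ :=
  ((PMF.uniformOfFintype β).map f).toMeasure

instance (f : β → ℝ) : IsProbabilityMeasure (uniformLaw f) := by
  unfold uniformLaw; infer_instance

theorem uniformLaw_Iic (f : β → ℝ) (t : ℝ) :
    uniformLaw f (Set.Iic t) = (PMF.uniformOfFintype β).toOuterMeasure {b | f b ≤ t} := by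
  rw [uniformLaw, PMF.toMeasure_apply_eq_toOuterMeasure_apply _ measurableSet_Iic,
    PMF.toOuterMeasure_map_apply]
  rfl

open Finset in
theorem charFun_uniformLaw (f : β → ℝ) (u : ℝ) :
    charFun (uniformLaw f) u = 𝔼 b, Complex.exp ((u * f b : ℝ) * Complex.I) := by
  let _ : MeasurableSpace β := ⊤
  have hf : Measurable f := measurable_from_top
  rw [charFun_apply_real, uniformLaw, ← PMF.toMeasure_map f _ hf, integral_map hf.aemeasurable
    (by fun_prop), PMF.integral_eq_sum, Fintype.expect_eq_sum_div_card, Finset.sum_div]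
  refine Finset.sum_congr rfl fun b _ => ?_
  simp [div_eq_inv_mul]

end UniformLaw

/-! ### The stratified statistic -/

section Strata

variable {S : ℕ} {m : ℕ → ℕ} {b c : ℕ → ℕ → ℝ}

/-- The first `m s` scores of every stratum `s < S`, as a family of functions on finite types. -/
def strataScores (S : ℕ) (m : ℕ → ℕ) (b : ℕ → ℕ → ℝ) (s : Fin S) (i : Fin (m s)) : ℝ := b s i

theorem stratVar_eq_prodVar :
    stratVar S m b c = prodVar (strataScores S m b) (strataScores S m c) := by
  simp only [stratVar, prodVar, Finset.sum_range, strataScores, Fintype.card_fin]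
  exact Finset.sum_congr rfl fun s _ => by ring

theorem stratThird_eq_prodThird :
    stratThird S m b c = prodThird (strataScores S m b) (strataScores S m c) := by
  simp only [stratThird, prodThird, Finset.sum_range, strataScores, Fintype.card_fin]

theorem stratFourth_eq_prodFourth :
    stratFourth S m b c = prodFourth (strataScores S m b) (strataScores S m c) := by
  simp only [stratFourth, prodFourth, Finset.sum_range, strataScores, Fintype.card_fin]
  exact Finset.sum_congr rfl fun s _ => by ring

/-- The stratified permutations are the families of permutations of the strata. -/
theorem stratPerm_eq_map : stratPerm S m = Finset.univ.map
    ⟨fun π : ∀ s : Fin S, Equiv.Perm (Fin (m s)) => Equiv.Perm.sigmaCongrRight π,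
      Equiv.Perm.sigmaCongrRightHom_injective⟩ := by
  ext π
  simp only [stratPerm, Finset.mem_filter, Finset.mem_univ, true_and, Finset.mem_map]
  constructor
  · intro h
    have hex : ∀ (s : Fin S) (i : Fin (m s)), ∃ j : Fin (m s), π ⟨s, i⟩ = ⟨s, j⟩ := by
      intro s i
      have hs := h ⟨s, i⟩
      generalize π ⟨s, i⟩ = z at hs
      obtain ⟨s', j⟩ := z
      obtain rfl : s' = s := hs
      exact ⟨j, rfl⟩
    choose σ hσ using hex
    have hinj : ∀ s, Function.Injective (σ s) := by
      intro s i j hij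
      have : π ⟨s, i⟩ = π ⟨s, j⟩ := by rw [hσ, hσ, hij]
      simpa using π.injective this
    refine ⟨fun s => Equiv.ofBijective _ (Finite.injective_iff_bijective.1 (hinj s)), ?_⟩
    ext1 ⟨s, i⟩
    exact (hσ s i).symm
  · rintro ⟨σ, rfl⟩ x
    rfl

theorem stratProbLE_eq (t : ℝ) : stratProbLE S m b c t =
    (uniformLaw fun π => prodPermSum (strataScores S m b) (strataScores S m c) π /
      √(stratVar S m b c)).real (Set.Iic t) := by
  classical
  rw [stratProbLE, measureReal_def, uniformLaw_Iic, stratUniform,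
    PMF.toOuterMeasure_uniformOfFinset_apply, PMF.toOuterMeasure_uniformOfFintype_apply]
  congr 2
  · simp only [stratPerm_eq_map, Finset.filter_map, Finset.card_map, Fintype.card_subtype,
      Set.coe_ofPred]
    rfl
  · simp only [stratPerm_eq_map, Finset.card_map, Finset.card_univ]

/-- The combinatorial central limit theorem for deterministic scores, in `ε`-`δ` form. -/
theorem exists_delta_abs_stratProbLE_sub_lt {σsq : ℝ} (hσsq : 0 < σsq) (t : ℝ) {ε : ℝ}
    (hε : 0 < ε) : ∃ δ > 0, ∀ (S : ℕ) (m : ℕ → ℕ) (b c : ℕ → ℕ → ℝ), (∀ s < S, 2 ≤ m s) →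
      (∀ s < S, ∑ i ∈ Finset.range (m s), b s i = 0 ∧ ∑ i ∈ Finset.range (m s), c s i = 0) →
      |stratVar S m b c - σsq| < δ → |stratThird S m b c| < δ → |stratFourth S m b c| < δ →
      |stratProbLE S m b c t - cdf (gaussianReal 0 1) t| < ε := by
  by_contra! H
  -- a sequence of counterexamples whose scores satisfy the hypotheses ever more closely
  choose S m b c hm hcent hv h3 h4 hbad using
    fun k : ℕ => H (1 / ((k : ℝ) + 1)) Nat.one_div_pos_of_nat
  have h0 := tendsto_one_div_add_atTop_nhds_zero_nat (𝕜 := ℝ)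
  have hv' : Tendsto (fun k => stratVar (S k) (m k) (b k) (c k)) atTop (𝓝 σsq) :=
    tendsto_iff_norm_sub_tendsto_zero.2 <|
      squeeze_zero (fun _ => norm_nonneg _) (fun k => (hv k).le) h0
  have h3' : Tendsto (fun k => stratThird (S k) (m k) (b k) (c k)) atTop (𝓝 0) :=
    squeeze_zero_norm (fun k => (h3 k).le) h0
  have h4' : Tendsto (fun k => stratFourth (S k) (m k) (b k) (c k)) atTop (𝓝 0) :=
    squeeze_zero_norm (fun k => (h4 k).le) h0
  let μ : ℕ → ProbabilityMeasure ℝ := fun k =>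
    ⟨uniformLaw fun π => prodPermSum (strataScores (S k) (m k) (b k))
      (strataScores (S k) (m k) (c k)) π / √(stratVar (S k) (m k) (b k) (c k)), inferInstance⟩
  let γ : ProbabilityMeasure ℝ := ⟨gaussianReal 0 1, inferInstance⟩
  have hμ : Tendsto μ atTop (𝓝 γ) := by
    refine ProbabilityMeasure.tendsto_iff_tendsto_charFun.2 fun u => ?_
    have hw : Tendsto (fun k => u / √(stratVar (S k) (m k) (b k) (c k))) atTop
        (𝓝 (u / √σsq)) :=
      tendsto_const_nhds.div hv'.sqrt (Real.sqrt_pos.2 hσsq).ne'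
    have herr : Tendsto (fun k => |u / √(stratVar (S k) (m k) (b k) (c k))| *
        (48 * (u / √(stratVar (S k) (m k) (b k) (c k))) ^ 2 *
          stratThird (S k) (m k) (b k) (c k) + |u / √(stratVar (S k) (m k) (b k) (c k))| *
            √(5 / 2 * stratFourth (S k) (m k) (b k) (c k)))) atTop (𝓝 0) := by
      have := hw.abs.mul ((((hw.pow 2).const_mul 48).mul h3').add
        (hw.abs.mul (h4'.const_mul (5 / 2)).sqrt))
      simpa using this
    refine tendsto_iff_norm_sub_tendsto_zero.2 (squeeze_zero' (.of_forall fun _ => norm_nonneg _)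
      ?_ herr)
    filter_upwards [hv'.eventually (lt_mem_nhds hσsq)] with k hk
    have hbound := norm_prodPermCharFun_sub_le
      (x := strataScores (S k) (m k) (b k)) (y := strataScores (S k) (m k) (c k))
      (fun s => by simpa using hm k s s.2)
      (fun s => by
        have := (hcent k s s.2).1
        rwa [Finset.sum_range] at this)
      (fun s => by
        have := (hcent k s s.2).2
        rwa [Finset.sum_range] at this)
      (u / √(stratVar (S k) (m k) (b k) (c k)))
    rw [← stratThird_eq_prodThird, ← stratFourth_eq_prodFourth, ← stratVar_eq_prodVar,
      div_pow, Real.sq_sqrt hk.le, mul_div_cancel₀ _ hk.ne'] at hbound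
    rw [div_pow, Real.sq_sqrt hk.le]
    have hμk : charFun (μ k : Measure ℝ) u =
        prodPermCharFun (strataScores (S k) (m k) (b k)) (strataScores (S k) (m k) (c k))
          (u / √(stratVar (S k) (m k) (b k) (c k))) := by
      refine (charFun_uniformLaw _ u).trans (Finset.expect_congr rfl fun π _ => ?_)
      congr 3
      ring
    have hγ : charFun (γ : Measure ℝ) u = (Real.exp (-(u ^ 2 / 2)) : ℝ) := by
      refine (charFun_gaussianReal u).trans ?_
      push_cast
      congr 1
      simp
    rwa [hμk, hγ]
  have hlim : Tendsto (fun k => stratProbLE (S k) (m k) (b k) (c k) t) atTop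
      (𝓝 (cdf (gaussianReal 0 1) t)) := by
    have hfr : (γ : Measure ℝ) (frontier (Set.Iic t)) = 0 := by
      have : NullSingletonClass (γ : Measure ℝ) := nullSingletonClass_gaussianReal one_ne_zero
      rw [frontier_Iic]
      exact measure_singleton t
    have := ProbabilityMeasure.tendsto_measure_of_null_frontier_of_tendsto' hμ hfr
    have := (ENNReal.tendsto_toReal (measure_ne_top _ _)).comp this
    rw [cdf_eq_real]
    simp only [stratProbLE_eq]
    exact this
  have := (tendsto_iff_norm_sub_tendsto_zero.1 hlim).eventually (gt_mem_nhds hε)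
  obtain ⟨k, hk⟩ := this.exists
  exact absurd hk (not_lt.2 (hbad k))

end Strata

/-! ### Random strata and scores -/

theorem lemma2 {Ω : ℕ → Type*} [∀ n, MeasurableSpace (Ω n)]
    (P : ∀ n, Measure (Ω n)) [∀ n, IsProbabilityMeasure (P n)]
    -- number of strata, strata sizes, and scores: random variables for each `n`
    (S : ∀ n, Ω n → ℕ) (m : ∀ n, Ω n → ℕ → ℕ) (b c : ∀ n, Ω n → ℕ → ℕ → ℝ)
    (hS : ∀ n, Measurable (S n)) (hm : ∀ n, Measurable (m n))
    (hb : ∀ n, Measurable (b n)) (hc : ∀ n, Measurable (c n))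
    (hS_pos : ∀ n, 2 ≤ n → ∀ᵐ ω ∂(P n), 1 ≤ S n ω)
    (hm_two : ∀ n, 2 ≤ n → ∀ᵐ ω ∂(P n), ∀ s < S n ω, 2 ≤ m n ω s)
    (hm_sum : ∀ n, 2 ≤ n → ∀ᵐ ω ∂(P n), ∑ s ∈ Finset.range (S n ω), m n ω s = n)
    (hcentered : ∀ n, 2 ≤ n → ∀ᵐ ω ∂(P n), ∀ s < S n ω,
      ∑ i ∈ Finset.range (m n ω s), b n ω s i = 0 ∧
      ∑ i ∈ Finset.range (m n ω s), c n ω s i = 0)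
    (σsq : ℝ) (hσsq : 0 < σsq)
    (hvar : TendstoInProb P (fun n ω => stratVar (S n ω) (m n ω) (b n ω) (c n ω)) σsq)
    (hthird : TendstoInProb P (fun n ω => stratThird (S n ω) (m n ω) (b n ω) (c n ω)) 0)
    (hfourth : TendstoInProb P (fun n ω => stratFourth (S n ω) (m n ω) (b n ω) (c n ω)) 0)
    (t : ℝ) :
    TendstoInProb P (fun n ω => stratProbLE (S n ω) (m n ω) (b n ω) (c n ω) t)
      (cdf (gaussianReal 0 1) t) := by
  intro ε hε
  obtain ⟨δ, hδ, H⟩ := exists_delta_abs_stratProbLE_sub_lt hσsq t hε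
  have hlim := ((hvar δ hδ).add (hthird δ hδ)).add (hfourth δ hδ)
  simp only [add_zero] at hlim
  refine tendsto_of_tendsto_of_tendsto_of_le_of_le' tendsto_const_nhds hlim
    (.of_forall fun _ => zero_le) ?_
  filter_upwards [eventually_ge_atTop 2] with n hn
  have hsub : ∀ᵐ ω ∂P n,
      ω ∈ {ω | ε ≤ |stratProbLE (S n ω) (m n ω) (b n ω) (c n ω) t - cdf (gaussianReal 0 1) t|} →
      ω ∈ {ω | δ ≤ |stratVar (S n ω) (m n ω) (b n ω) (c n ω) - σsq|} ∪
        {ω | δ ≤ |stratThird (S n ω) (m n ω) (b n ω) (c n ω) - 0|} ∪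
        {ω | δ ≤ |stratFourth (S n ω) (m n ω) (b n ω) (c n ω) - 0|} := by
    filter_upwards [hm_two n hn, hcentered n hn] with ω h2 h0 hω
    by_contra hcon
    simp only [Set.mem_union, Set.mem_ofPred_eq, not_or, not_le, sub_zero] at hcon
    exact absurd (H _ _ _ _ h2 h0 hcon.1.1 hcon.1.2 hcon.2) (not_lt.2 hω)
  exact (measure_mono_ae hsub).trans
    ((measure_union_le _ _).trans (add_le_add_left (measure_union_le _ _) _))
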